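/- Let $\mathfrak g$ be a finite-dimensional real nilpotent Lie algebra and let $H\in\wedge^3\mathfrak g^*$ be closed for the Chevalley–Eilenberg differential. Equip $\mathfrak g\oplus\mathfrak g^*$ with the natural pairing $\langle X+\xi,Y+\eta\rangle=\tfrac12(\eta(X)+\xi(Y))$ and the Courant bracket $$[\![X+\xi,Y+\eta]\!]=[X,Y]+\mathcal L_X\eta-\mathcal L_Y\xi+i_Yi_XH ,\qquad \mathcal L_X\eta=-\eta([X,\cdot\,]).$$ A generalized complex structure on $(\mathfrak g,H)$ is a linear map $\mathcal J$ on $\mathfrak g\oplus\mathfrak g^*$ with $\mathcal J^2=-1$ that preserves the pairing and whose $i$-eigenspace in $(\mathfrak g\oplus\mathfrak g^*)\otimes\mathbb C$ is closed under the complex bilinear extension of the Courant bracket. A generalized Kähler structure on $(\mathfrak g,H)$ is a pair of commuting generalized complex structures $\mathcal J_1,\mathcal J_2$ such that $\langle\mathcal J_1\mathcal J_2v,v\rangle>0$ for all nonzero $v\in\mathfrak g\oplus\mathfrak g^*$. Theorem 4.1. If $(\mathfrak g,H)$ admits a generalized Kähler structure, then $\mathfrak g$ is abelian. -/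

import Mathlib

open scoped TensorProduct

namespace GenKahler

variable {𝔤 : Type*} [LieRing 𝔤] [LieAlgebra ℝ 𝔤]

/-- An element `H` of `⋀³ 𝔤*` (an alternating trilinear form on `𝔤`) is closed if its
Chevalley–Eilenberg differential
`(dH)(x₀, x₁, x₂, x₃) = ∑_{i < j} (-1)^(i+j) H([xᵢ, xⱼ], …, x̂ᵢ, …, x̂ⱼ, …)` vanishes. -/
def IsClosedThreeForm (H : 𝔤 [⋀^Fin 3]→ₗ[ℝ] ℝ) : Prop :=
  ∀ x₀ x₁ x₂ x₃ : 𝔤,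
    - H ![⁅x₀, x₁⁆, x₂, x₃] + H ![⁅x₀, x₂⁆, x₁, x₃] - H ![⁅x₀, x₃⁆, x₁, x₂]
      - H ![⁅x₁, x₂⁆, x₀, x₃] + H ![⁅x₁, x₃⁆, x₀, x₂] - H ![⁅x₂, x₃⁆, x₀, x₁] = 0

/-- The Lie derivative `𝓛_X η = i_X dη` of `η ∈ 𝔤*`; as `dη(X, Y) = -η([X, Y])`, this is
`Y ↦ -η([X, Y])`. -/
def lieDeriv (X : 𝔤) (η : Module.Dual ℝ 𝔤) : Module.Dual ℝ 𝔤 :=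
  -(η ∘ₗ (LieAlgebra.ad ℝ 𝔤 X : 𝔤 →ₗ[ℝ] 𝔤))

theorem map_add₀ (H : 𝔤 [⋀^Fin 3]→ₗ[ℝ] ℝ) (x x' y z : 𝔤) :
    H ![x + x', y, z] = H ![x, y, z] + H ![x', y, z] := by
  have h := H.toMultilinearMap.map_update_add ![0, y, z] 0 x x'
  have e : ∀ t, Function.update ![0, y, z] 0 t = ![t, y, z] := fun t => by
    funext i; fin_cases i <;> rfl
  simp only [e] at h
  exact h

theorem map_smul₀ (H : 𝔤 [⋀^Fin 3]→ₗ[ℝ] ℝ) (c : ℝ) (x y z : 𝔤) :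
    H ![c • x, y, z] = c * H ![x, y, z] := by
  have h := H.toMultilinearMap.map_update_smul ![0, y, z] 0 c x
  have e : ∀ t, Function.update ![0, y, z] 0 t = ![t, y, z] := fun t => by
    funext i; fin_cases i <;> rfl
  simp only [e] at h
  exact h

theorem map_add₁ (H : 𝔤 [⋀^Fin 3]→ₗ[ℝ] ℝ) (x y y' z : 𝔤) :
    H ![x, y + y', z] = H ![x, y, z] + H ![x, y', z] := by
  have h := H.toMultilinearMap.map_update_add ![x, 0, z] 1 y y'
  have e : ∀ t, Function.update ![x, 0, z] 1 t = ![x, t, z] := fun t => by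
    funext i; fin_cases i <;> rfl
  simp only [e] at h
  exact h

theorem map_smul₁ (H : 𝔤 [⋀^Fin 3]→ₗ[ℝ] ℝ) (c : ℝ) (x y z : 𝔤) :
    H ![x, c • y, z] = c * H ![x, y, z] := by
  have h := H.toMultilinearMap.map_update_smul ![x, 0, z] 1 c y
  have e : ∀ t, Function.update ![x, 0, z] 1 t = ![x, t, z] := fun t => by
    funext i; fin_cases i <;> rfl
  simp only [e] at h
  exact h

theorem map_add₂ (H : 𝔤 [⋀^Fin 3]→ₗ[ℝ] ℝ) (x y z z' : 𝔤) :
    H ![x, y, z + z'] = H ![x, y, z] + H ![x, y, z'] := by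
  have h := H.toMultilinearMap.map_update_add ![x, y, 0] 2 z z'
  have e : ∀ t, Function.update ![x, y, 0] 2 t = ![x, y, t] := fun t => by
    funext i; fin_cases i <;> rfl
  simp only [e] at h
  exact h

theorem map_smul₂ (H : 𝔤 [⋀^Fin 3]→ₗ[ℝ] ℝ) (c : ℝ) (x y z : 𝔤) :
    H ![x, y, c • z] = c * H ![x, y, z] := by
  have h := H.toMultilinearMap.map_update_smul ![x, y, 0] 2 c z
  have e : ∀ t, Function.update ![x, y, 0] 2 t = ![x, y, t] := fun t => by
    funext i; fin_cases i <;> rfl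
  simp only [e] at h
  exact h

/-- The contraction `i_Y i_X H = H(X, Y, ·) ∈ 𝔤*`. -/
def contract (H : 𝔤 [⋀^Fin 3]→ₗ[ℝ] ℝ) (X Y : 𝔤) : Module.Dual ℝ 𝔤 where
  toFun Z := H ![X, Y, Z]
  map_add' Z Z' := map_add₂ H X Y Z Z'
  map_smul' c Z := map_smul₂ H c X Y Z

/-- The `H`-twisted Courant bracket on `𝔤 ⊕ 𝔤*`,
`⟦X + ξ, Y + η⟧ = [X, Y] + 𝓛_X η - 𝓛_Y ξ + i_Y i_X H`, as a real bilinear map. -/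
def courantBracket (H : 𝔤 [⋀^Fin 3]→ₗ[ℝ] ℝ) :
    LinearMap.BilinMap ℝ (𝔤 × Module.Dual ℝ 𝔤) (𝔤 × Module.Dual ℝ 𝔤) :=
  LinearMap.mk₂ ℝ
    (fun u v => (⁅u.1, v.1⁆, lieDeriv u.1 v.2 - lieDeriv v.1 u.2 + contract H u.1 v.1))
    (fun u u' v => Prod.ext (by simp) (LinearMap.ext fun Z => by
      simp [lieDeriv, contract, map_add₀]
      try ring))
    (fun c u v => Prod.ext (by simp) (LinearMap.ext fun Z => by
      simp [lieDeriv, contract, map_smul₀]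
      try ring))
    (fun u v v' => Prod.ext (by simp) (LinearMap.ext fun Z => by
      simp [lieDeriv, contract, map_add₁]
      try ring))
    (fun c u v => Prod.ext (by simp) (LinearMap.ext fun Z => by
      simp [lieDeriv, contract, map_smul₁]
      try ring))

/-- The natural symmetric pairing `⟨X + ξ, Y + η⟩ = ½ (η(X) + ξ(Y))` on `𝔤 ⊕ 𝔤*`. -/
noncomputable def pairing (u v : 𝔤 × Module.Dual ℝ 𝔤) : ℝ :=
  (1 / 2 : ℝ) * (v.2 u.1 + u.2 v.1)

/-- The `i`-eigenspace of (the complexification of) `J` in `(𝔤 ⊕ 𝔤*) ⊗ ℂ`. -/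
noncomputable def iEigenspace (J : Module.End ℝ (𝔤 × Module.Dual ℝ 𝔤)) :
    Submodule ℂ (ℂ ⊗[ℝ] (𝔤 × Module.Dual ℝ 𝔤)) :=
  Module.End.eigenspace (LinearMap.baseChange ℂ J) Complex.I

/-- A generalized complex structure on the Lie algebra `𝔤` with 3-form `H`: a linear complex
structure on `𝔤 ⊕ 𝔤*` that is orthogonal for the natural pairing and whose `i`-eigenspace is
closed under the (complex bilinear extension of the) Courant bracket. -/
structure IsGeneralizedComplex (H : 𝔤 [⋀^Fin 3]→ₗ[ℝ] ℝ)
    (J : Module.End ℝ (𝔤 × Module.Dual ℝ 𝔤)) : Prop where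
  sq : ∀ u, J (J u) = -u
  orthogonal : ∀ u v, pairing (J u) (J v) = pairing u v
  integrable : ∀ a ∈ iEigenspace J, ∀ b ∈ iEigenspace J,
    (courantBracket H).baseChange ℂ a b ∈ iEigenspace J

/-- A generalized Kähler structure on `𝔤` with 3-form `H`: two commuting generalized complex
structures with `⟨J₁ J₂ v, v⟩ > 0` for all `v ≠ 0` in `𝔤 ⊕ 𝔤*`. -/
structure IsGeneralizedKahler (H : 𝔤 [⋀^Fin 3]→ₗ[ℝ] ℝ)
    (J₁ J₂ : Module.End ℝ (𝔤 × Module.Dual ℝ 𝔤)) : Prop where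
  left : IsGeneralizedComplex H J₁
  right : IsGeneralizedComplex H J₂
  comm : ∀ u, J₁ (J₂ u) = J₂ (J₁ u)
  pos : ∀ v, v ≠ 0 → 0 < pairing (J₁ (J₂ v)) v

end GenKahler

/-!
The space `E = 𝔤 ⊕ 𝔤*` with the Courant bracket is a Lie algebra (as `H` is closed), the natural
pairing `Q` on it is invariant, and `E` is nilpotent because `𝔤` is. The theorem holds for any such
`E` (`bracket_eq_zero`): a generalized Kähler structure forces the bracket of `E` to vanish.

Put `K = J₁ J₂`. Then `K² = 1`, and `Q (K u) v` is an inner product, so `E = E₊ ⊕ E₋` with `Q`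
positive definite on `E₊` and negative definite on `E₋`. In a basis adapted to this splitting
(`IsSplitBasis`) the three-form `φ(u, v, w) = Q ([u, v], w)` has components of types `+++`, `++-`,
`+--`, `---`; let `α`, `β`, `γ`, `δ` be their squared norms, summed over the indices of the given
signs in the given order.

* The Killing form of a nilpotent Lie algebra vanishes (`trace_bracket_sq`). Its traces over `E₊`
  and `E₋` read `α - 2 β + γ = 0` and `δ - 2 γ + β = 0`.
* The `i`-eigenspaces of `J₁` and `J₂` are nilpotent Lie algebras as well, so their adjoint
  operators have trace zero (`trace_bracket_mul`). It follows that `∑ [eᵢ, J₁ eᵢ] = 0`, the sum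
  being over an orthonormal basis of `E₊`. By the Jacobi identity, the square of this vector is
  `2 ∑ Q ([eᵢ, eⱼ], [J₁ eᵢ, J₁ eⱼ])`. Integrability (`IsIntegrableComplex.form_eq`) says that `φ` has
  no `(3, 0)`-part for `J₁` and for `J₂`; comparing the two, `φ` is of type `(1, 1)` in its first
  two arguments on `++-`. This evaluates the sum as `2 (α / 3 - β)`, whence `α = 3 β`.

Together `β + γ = 0`, so all four norms vanish (`structureConstants_eq_zero`).
-/

namespace GenKahler

/-! ### The Courant bracket as a Lie bracket with an invariant pairing -/

section Courant

variable {𝔤 : Type*} [LieRing 𝔤] [LieAlgebra ℝ 𝔤]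

/-- The natural pairing on `𝔤 ⊕ 𝔤*` as a bilinear form. -/
noncomputable def pairingForm (𝔤 : Type*) [LieRing 𝔤] [LieAlgebra ℝ 𝔤] :
    LinearMap.BilinForm ℝ (𝔤 × Module.Dual ℝ 𝔤) :=
  LinearMap.mk₂ ℝ pairing
    (fun u u' v => by simp [pairing]; ring) (fun c u v => by simp [pairing]; ring)
    (fun u v v' => by simp [pairing]; ring) (fun c u v => by simp [pairing]; ring)

theorem pairing_comm (u v : 𝔤 × Module.Dual ℝ 𝔤) : pairing u v = pairing v u := by
  simp only [pairing]; ring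

theorem alternating_swap₀₁ (H : 𝔤 [⋀^Fin 3]→ₗ[ℝ] ℝ) (x y z : 𝔤) :
    H ![y, x, z] = -H ![x, y, z] := by
  have h := H.map_swap ![x, y, z] (show (0 : Fin 3) ≠ 1 by decide)
  rw [← h]
  congr 1
  funext i; fin_cases i <;> rfl

theorem alternating_swap₁₂ (H : 𝔤 [⋀^Fin 3]→ₗ[ℝ] ℝ) (x y z : 𝔤) :
    H ![x, z, y] = -H ![x, y, z] := by
  have h := H.map_swap ![x, y, z] (show (1 : Fin 3) ≠ 2 by decide)
  rw [← h]
  congr 1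
  funext i; fin_cases i <;> rfl

theorem courantBracket_apply (H : 𝔤 [⋀^Fin 3]→ₗ[ℝ] ℝ) (u v : 𝔤 × Module.Dual ℝ 𝔤) :
    courantBracket H u v =
      (⁅u.1, v.1⁆, lieDeriv u.1 v.2 - lieDeriv v.1 u.2 + contract H u.1 v.1) := rfl

theorem lieDeriv_apply (X Y : 𝔤) (η : Module.Dual ℝ 𝔤) : lieDeriv X η Y = -η ⁅X, Y⁆ := rfl

theorem contract_apply (H : 𝔤 [⋀^Fin 3]→ₗ[ℝ] ℝ) (X Y Z : 𝔤) :
    contract H X Y Z = H ![X, Y, Z] := rfl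

theorem courantBracket_skew (H : 𝔤 [⋀^Fin 3]→ₗ[ℝ] ℝ) (u v : 𝔤 × Module.Dual ℝ 𝔤) :
    courantBracket H u v = -courantBracket H v u := by
  refine Prod.ext ?_ (LinearMap.ext fun Z => ?_)
  · simp [courantBracket_apply]
  · simp only [courantBracket_apply, Prod.snd_neg, LinearMap.neg_apply, LinearMap.add_apply,
      LinearMap.sub_apply, contract_apply]
    rw [alternating_swap₀₁ H v.1 u.1 Z]
    ring

theorem pairing_courantBracket (H : 𝔤 [⋀^Fin 3]→ₗ[ℝ] ℝ) (u v w : 𝔤 × Module.Dual ℝ 𝔤) :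
    pairing (courantBracket H u v) w = -pairing v (courantBracket H u w) := by
  simp only [pairing, courantBracket_apply, LinearMap.add_apply, LinearMap.sub_apply,
    lieDeriv_apply, contract_apply]
  rw [alternating_swap₁₂ H u.1 v.1 w.1, ← lie_skew v.1 w.1, map_neg]
  ring

theorem courantBracket_leibniz {H : 𝔤 [⋀^Fin 3]→ₗ[ℝ] ℝ} (hH : IsClosedThreeForm H)
    (u v w : 𝔤 × Module.Dual ℝ 𝔤) :
    courantBracket H (courantBracket H u v) w =
      courantBracket H u (courantBracket H v w) - courantBracket H v (courantBracket H u w) := by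
  refine Prod.ext ?_ (LinearMap.ext fun Z => ?_)
  · simp [courantBracket_apply]
  · have hc := hH u.1 v.1 w.1 Z
    simp only [courantBracket_apply, LinearMap.add_apply, LinearMap.sub_apply, Prod.snd_sub,
      lieDeriv_apply, contract_apply, lie_lie, map_sub]
    have e1 := alternating_swap₀₁ H u.1 ⁅v.1, w.1⁆ Z
    have e2 := alternating_swap₀₁ H v.1 ⁅u.1, w.1⁆ Z
    have e3 : H ![v.1, w.1, ⁅u.1, Z⁆] = H ![⁅u.1, Z⁆, v.1, w.1] := by
      rw [alternating_swap₁₂ H v.1 ⁅u.1, Z⁆ w.1, alternating_swap₀₁ H ⁅u.1, Z⁆ v.1 w.1, neg_neg]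
    have e4 : H ![u.1, w.1, ⁅v.1, Z⁆] = H ![⁅v.1, Z⁆, u.1, w.1] := by
      rw [alternating_swap₁₂ H u.1 ⁅v.1, Z⁆ w.1, alternating_swap₀₁ H ⁅v.1, Z⁆ u.1 w.1, neg_neg]
    have e5 : H ![u.1, v.1, ⁅w.1, Z⁆] = H ![⁅w.1, Z⁆, u.1, v.1] := by
      rw [alternating_swap₁₂ H u.1 ⁅w.1, Z⁆ v.1, alternating_swap₀₁ H ⁅w.1, Z⁆ u.1 v.1, neg_neg]
    linarith

/-! ### The real form of integrability -/

theorem one_tmul_sub_I_tmul_eq_zero {E : Type*} [AddCommGroup E] [Module ℝ E] {x y : E}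
    (h : (1 : ℂ) ⊗ₜ[ℝ] x = Complex.I ⊗ₜ[ℝ] y) : x = 0 := by
  have h' := congrArg (fun t => TensorProduct.lid ℝ E (LinearMap.rTensor E Complex.reLm t)) h
  simpa using h'

/-- The vector `v - i J v` lies in the `i`-eigenspace of `J` when `J² = -1`. -/
theorem one_tmul_sub_mem_iEigenspace {J : Module.End ℝ (𝔤 × Module.Dual ℝ 𝔤)}
    (hJ : ∀ u, J (J u) = -u) (v : 𝔤 × Module.Dual ℝ 𝔤) :
    (1 : ℂ) ⊗ₜ[ℝ] v - Complex.I ⊗ₜ[ℝ] J v ∈ iEigenspace J := by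
  rw [iEigenspace, Module.End.mem_eigenspace_iff]
  simp only [map_sub, LinearMap.baseChange_tmul, hJ, smul_sub, TensorProduct.smul_tmul',
    smul_eq_mul, mul_one, Complex.I_mul_I, TensorProduct.neg_tmul, TensorProduct.tmul_neg]
  abel

/-- Integrability in real terms: the bracket of `v - i J v` and `w - i J w` is `x - i y` with
`x = ⟦v, w⟧ - ⟦J v, J w⟧` and `y = ⟦J v, w⟧ + ⟦v, J w⟧`, and this is an `i`-eigenvector exactly when
`J x = y`. -/
theorem IsGeneralizedComplex.map_bracket {H : 𝔤 [⋀^Fin 3]→ₗ[ℝ] ℝ}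
    {J : Module.End ℝ (𝔤 × Module.Dual ℝ 𝔤)} (hJ : IsGeneralizedComplex H J)
    (v w : 𝔤 × Module.Dual ℝ 𝔤) :
    J (courantBracket H v w - courantBracket H (J v) (J w)) =
      courantBracket H (J v) w + courantBracket H v (J w) := by
  have h := hJ.integrable _ (one_tmul_sub_mem_iEigenspace hJ.sq v)
    _ (one_tmul_sub_mem_iEigenspace hJ.sq w)
  have hneg (x : 𝔤 × Module.Dual ℝ 𝔤) : (-1 : ℂ) ⊗ₜ[ℝ] x = -((1 : ℂ) ⊗ₜ[ℝ] x) :=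
    TensorProduct.neg_tmul _ _
  rw [iEigenspace, Module.End.mem_eigenspace_iff] at h
  simp only [map_sub, map_neg, LinearMap.sub_apply, LinearMap.BilinMap.baseChange_tmul, smul_sub,
    smul_neg, LinearMap.baseChange_tmul, TensorProduct.smul_tmul', smul_eq_mul, mul_one, one_mul,
    Complex.I_mul_I, hneg] at h
  rw [← sub_eq_zero]
  apply one_tmul_sub_I_tmul_eq_zero
    (y := J (courantBracket H (J v) w + courantBracket H v (J w))
      + (courantBracket H v w - courantBracket H (J v) (J w)))
  simp only [map_sub, map_add, TensorProduct.tmul_sub, TensorProduct.tmul_add]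
  rw [← sub_eq_zero] at h ⊢
  rw [← h]
  abel

/-! ### Nilpotency of the Courant bracket -/

/-- A descending filtration of `𝔤 ⊕ 𝔤*` by powers of the Courant bracket: if the lower central
series `Cᵏ` of `𝔤` vanishes at `k = c`, the `n`-th term consists of the `X + ξ` with `X ∈ Cⁿ` and
`ξ` vanishing on `C²ᶜ⁻ⁿ`. The subtraction is truncated, so from `n = 2 c` on, `ξ = 0`. -/
def courantFiltration (𝔤 : Type*) [LieRing 𝔤] [LieAlgebra ℝ 𝔤] (c n : ℕ) :
    Submodule ℝ (𝔤 × Module.Dual ℝ 𝔤) :=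
  (LieModule.lowerCentralSeries ℝ 𝔤 𝔤 n).toSubmodule.prod
    (LieModule.lowerCentralSeries ℝ 𝔤 𝔤 (2 * c - n)).toSubmodule.dualAnnihilator

theorem mem_courantFiltration {c n : ℕ} {u : 𝔤 × Module.Dual ℝ 𝔤} :
    u ∈ courantFiltration 𝔤 c n ↔ u.1 ∈ LieModule.lowerCentralSeries ℝ 𝔤 𝔤 n ∧
      ∀ Y ∈ LieModule.lowerCentralSeries ℝ 𝔤 𝔤 (2 * c - n), u.2 Y = 0 := by
  simp [courantFiltration, Submodule.mem_prod, Submodule.mem_dualAnnihilator]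

theorem lie_mem_lowerCentralSeries_succ {n : ℕ} (X : 𝔤) {Y : 𝔤}
    (hY : Y ∈ LieModule.lowerCentralSeries ℝ 𝔤 𝔤 n) :
    ⁅X, Y⁆ ∈ LieModule.lowerCentralSeries ℝ 𝔤 𝔤 (n + 1) := by
  rw [LieModule.lowerCentralSeries_succ]
  exact LieSubmodule.lie_mem_lie (LieSubmodule.mem_top X) hY

theorem courantBracket_mem_courantFiltration (H : 𝔤 [⋀^Fin 3]→ₗ[ℝ] ℝ) {c : ℕ}
    (hc : LieModule.lowerCentralSeries ℝ 𝔤 𝔤 c = ⊥) (n : ℕ) (v : 𝔤 × Module.Dual ℝ 𝔤)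
    {u : 𝔤 × Module.Dual ℝ 𝔤} (hu : u ∈ courantFiltration 𝔤 c n) :
    courantBracket H v u ∈ courantFiltration 𝔤 c (n + 1) := by
  have hbot : ∀ k, c ≤ k → ∀ Y ∈ LieModule.lowerCentralSeries ℝ 𝔤 𝔤 k, Y = 0 := by
    intro k hk Y hY
    have := LieModule.antitone_lowerCentralSeries ℝ 𝔤 𝔤 hk hY
    rwa [hc, LieSubmodule.mem_bot] at this
  rw [mem_courantFiltration] at hu ⊢
  refine ⟨lie_mem_lowerCentralSeries_succ v.1 hu.1, fun Y hY => ?_⟩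
  rcases lt_or_ge n c with h | h
  · rw [hbot _ (by omega) Y hY, map_zero]
  · have h1 : u.1 = 0 := hbot n h _ hu.1
    have h2 : u.2 ⁅v.1, Y⁆ = 0 := by
      apply hu.2
      rcases lt_or_ge n (2 * c) with h' | h'
      · have := lie_mem_lowerCentralSeries_succ v.1 hY
        rwa [show 2 * c - (n + 1) + 1 = 2 * c - n by omega] at this
      · rw [show 2 * c - n = 0 by omega, LieModule.lowerCentralSeries_zero]
        exact LieSubmodule.mem_top _
    have h3 : contract H v.1 0 Y = 0 := by
      have := map_smul₁ H 0 v.1 0 Y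
      simpa [contract_apply] using this
    simp [courantBracket_apply, h1, h2, h3, lieDeriv_apply]

theorem courantFiltration_zero {c : ℕ} (hc : LieModule.lowerCentralSeries ℝ 𝔤 𝔤 c = ⊥) :
    courantFiltration 𝔤 c 0 = ⊤ := by
  rw [eq_top_iff]
  intro u _
  rw [mem_courantFiltration]
  refine ⟨by simp, fun Y hY => ?_⟩
  have := LieModule.antitone_lowerCentralSeries ℝ 𝔤 𝔤 (show c ≤ 2 * c - 0 by omega) hY
  rw [hc, LieSubmodule.mem_bot] at this
  rw [this, map_zero]

theorem courantFiltration_two_mul {c : ℕ} (hc : LieModule.lowerCentralSeries ℝ 𝔤 𝔤 c = ⊥) :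
    courantFiltration 𝔤 c (2 * c) = ⊥ := by
  rw [eq_bot_iff]
  intro u hu
  rw [mem_courantFiltration] at hu
  have h1 := LieModule.antitone_lowerCentralSeries ℝ 𝔤 𝔤 (show c ≤ 2 * c by omega) hu.1
  rw [hc, LieSubmodule.mem_bot] at h1
  rw [Submodule.mem_bot]
  exact Prod.ext h1 (LinearMap.ext fun Y => hu.2 Y (by simp))

end Courant

/-! ### Quadratic Lie algebras, complex structures and split bases -/

section Abstract

variable {E : Type*} [AddCommGroup E] [Module ℝ E]

/-- `B` is a Lie bracket on `E` for which the symmetric bilinear form `Q` is invariant, and `E` is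
nilpotent: some descending filtration `N` from `⊤` to `⊥` satisfies `[E, Nₖ] ⊆ Nₖ₊₁`. -/
structure IsNilpotentQuadratic (B : LinearMap.BilinMap ℝ E E) (Q : LinearMap.BilinForm ℝ E) :
    Prop where
  symm : ∀ u v, Q u v = Q v u
  skew : ∀ u v, B u v = -B v u
  leibniz : ∀ u v w, B (B u v) w = B u (B v w) - B v (B u w)
  invariant : ∀ u v w, Q (B u v) w = -Q v (B u w)
  nilpotent : ∃ (N : ℕ → Submodule ℝ E) (m : ℕ), N 0 = ⊤ ∧ N m = ⊥ ∧
    ∀ n u, ∀ v ∈ N n, B u v ∈ N (n + 1)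

/-- The real form of a generalized complex structure: `J² = -1`, `J` preserves `Q`, and the Lie
bracket of the `i`-eigenvectors `v - i J v` and `w - i J w` is again an `i`-eigenvector. -/
structure IsIntegrableComplex (B : LinearMap.BilinMap ℝ E E) (Q : LinearMap.BilinForm ℝ E)
    (J : Module.End ℝ E) : Prop where
  sq : ∀ u, J (J u) = -u
  orthogonal : ∀ u v, Q (J u) (J v) = Q u v
  map_bracket : ∀ v w, J (B v w - B (J v) (J w)) = B (J v) w + B v (J w)

/-- A basis `e` of eigenvectors of `K` with eigenvalues `s i = ±1` that is orthogonal for `Q`, with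
`Q (e i) (e i) = s i`. -/
structure IsSplitBasis {ι : Type*} [DecidableEq ι] (Q : LinearMap.BilinForm ℝ E)
    (K : Module.End ℝ E) (e : Module.Basis ι ℝ E) (s : ι → ℝ) : Prop where
  sign : ∀ i, s i = 1 ∨ s i = -1
  apply : ∀ i, K (e i) = s i • e i
  form : ∀ i j, Q (e i) (e j) = if i = j then s i else 0

/-- Diagonalize `K`, which is symmetric for the inner product `Q (K u) v`. -/
theorem exists_isSplitBasis [FiniteDimensional ℝ E] {Q : LinearMap.BilinForm ℝ E}
    {K : Module.End ℝ E} (hQ : ∀ u v, Q u v = Q v u) (hK : ∀ u, K (K u) = u)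
    (hKQ : ∀ u v, Q (K u) v = Q u (K v)) (hpos : ∀ u, u ≠ 0 → 0 < Q (K u) u) :
    ∃ (n : ℕ) (e : Module.Basis (Fin n) ℝ E) (s : Fin n → ℝ), IsSplitBasis Q K e s := by
  let core : InnerProductSpace.Core ℝ E :=
    { inner := fun u v => Q (K u) v
      conj_inner_symm := fun u v => by
        simp only [conj_trivial]
        rw [hKQ, hQ]
      re_inner_nonneg := fun u => by
        rcases eq_or_ne u 0 with rfl | h
        · simp
        · exact (hpos u h).le
      add_left := fun u v w => by simp
      smul_left := fun u v r => by simp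
      definite := fun u h => by
        by_contra hu
        exact (hpos u hu).ne' h }
  let _ : NormedAddCommGroup E := core.toNormedAddCommGroup
  let _ : InnerProductSpace ℝ E := InnerProductSpace.ofCore core.toCore
  have hinner : ∀ u v : E, inner ℝ u v = Q (K u) v := fun _ _ => rfl
  have hsymm : LinearMap.IsSymmetric K := fun u v => by
    rw [hinner, hinner, hKQ (K u)]
  let b := hsymm.eigenvectorBasis rfl
  let s := hsymm.eigenvalues rfl
  have happ : ∀ i, K (b i) = s i • b i := fun i => hsymm.apply_eigenvectorBasis rfl i
  have hne : ∀ i, b i ≠ 0 := fun i => b.orthonormal.ne_zero i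
  have hs : ∀ i, s i * s i = 1 := fun i => by
    have h := hK (b i)
    rw [happ, map_smul, happ, smul_smul] at h
    have h' : (s i * s i - 1) • b i = 0 := by rw [sub_smul, h, one_smul, sub_self]
    have := (smul_eq_zero.mp h').resolve_right (hne i)
    linarith
  refine ⟨_, b.toBasis, s, ⟨fun i => mul_self_eq_one_iff.mp (hs i), fun i => ?_, fun i j => ?_⟩⟩
  · rw [OrthonormalBasis.coe_toBasis]; exact happ i
  · rw [OrthonormalBasis.coe_toBasis]
    have h := orthonormal_iff_ite.mp b.orthonormal i j
    rw [hinner, happ, map_smul, LinearMap.smul_apply, smul_eq_mul] at h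
    have h' : Q (b i) (b j) = s i * (s i * Q (b i) (b j)) := by rw [← mul_assoc, hs, one_mul]
    rw [h', h]
    split <;> simp

namespace IsNilpotentQuadratic

variable {B : LinearMap.BilinMap ℝ E E} {Q : LinearMap.BilinForm ℝ E}
  (hB : IsNilpotentQuadratic B Q)
include hB

theorem cyclic (u v w : E) : Q (B u v) w = Q (B v w) u := by
  rw [hB.skew u v, map_neg, LinearMap.neg_apply, hB.invariant, neg_neg, hB.symm]

theorem swap₀₁ (u v w : E) : Q (B v u) w = -Q (B u v) w := by
  rw [hB.skew v u, map_neg, LinearMap.neg_apply]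

theorem swap₁₂ (u v w : E) : Q (B u w) v = -Q (B u v) w := by
  rw [hB.invariant, hB.symm]

end IsNilpotentQuadratic

/-! ### Vanishing traces -/

theorem isNilpotent_of_filtration {N : ℕ → Submodule ℝ E} {m : ℕ} (h0 : N 0 = ⊤) (hm : N m = ⊥)
    {T : Module.End ℝ E} (hT : ∀ n, ∀ v ∈ N n, T v ∈ N (n + 1)) : IsNilpotent T := by
  refine ⟨m, LinearMap.ext fun v => ?_⟩
  have h : ∀ n, (T ^ n) v ∈ N n := by
    intro n
    induction n with
    | zero => rw [h0]; exact Submodule.mem_top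
    | succ n ih => rw [pow_succ', Module.End.mul_apply]; exact hT n _ ih
  simpa [hm] using h m

theorem trace_eq_zero_of_isNilpotent {T : Module.End ℝ E} (hT : IsNilpotent T) :
    LinearMap.trace ℝ E T = 0 :=
  (LinearMap.isNilpotent_trace_of_isNilpotent hT).eq_zero

/-- Integrability of `J`: the invariant three-form `Q ([u, v], w)` has no `(3, 0)`-part. -/
theorem IsIntegrableComplex.form_eq {B : LinearMap.BilinMap ℝ E E}
    {Q : LinearMap.BilinForm ℝ E} {J : Module.End ℝ E}
    (hJ : IsIntegrableComplex B Q J) (u v w : E) :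
    Q (B u v) w = Q (B (J u) (J v)) w + Q (B (J u) v) (J w) + Q (B u (J v)) (J w) := by
  have h := congrArg (fun t => Q t (J w)) (hJ.map_bracket u v)
  simp only [hJ.orthogonal, map_sub, map_add, LinearMap.sub_apply, LinearMap.add_apply] at h
  linarith

section Trace

variable {B : LinearMap.BilinMap ℝ E E} {Q : LinearMap.BilinForm ℝ E}
  (hB : IsNilpotentQuadratic B Q)
include hB

/-- The Killing form of a nilpotent Lie algebra vanishes. -/
theorem IsNilpotentQuadratic.trace_bracket_sq (x : E) :
    LinearMap.trace ℝ E (B x * B x) = 0 := by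
  obtain ⟨N, m, h0, hm, hN⟩ := hB.nilpotent
  have h : IsNilpotent (B x) := isNilpotent_of_filtration h0 hm fun n v hv => hN n x v hv
  apply trace_eq_zero_of_isNilpotent
  rw [← pow_two]
  exact h.pow_succ 1

/-- Under the isomorphism `v ↦ v - i J v` of `E` with the `i`-eigenspace of `J`, the adjoint action
of `v - i J v` becomes `w ↦ [v, w] - [J v, J w]`. It is nilpotent because its powers, and `J`
composed with them, are combinations of iterated brackets of `E`. For `v = J y` this operator is
`ad (J y) + ad y ∘ J`, and `ad (J y)` is traceless as well. -/
theorem IsNilpotentQuadratic.trace_bracket_mul {J : Module.End ℝ E}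
    (hJ : IsIntegrableComplex B Q J) (y : E) :
    LinearMap.trace ℝ E (B y * J) = 0 := by
  obtain ⟨N, m, h0, hm, hN⟩ := hB.nilpotent
  have h1 : LinearMap.trace ℝ E (B (J y)) = 0 :=
    trace_eq_zero_of_isNilpotent
      (isNilpotent_of_filtration h0 hm fun n v hv => hN n (J y) v hv)
  have h2 : LinearMap.trace ℝ E (B (J y) + B y * J) = 0 := by
    apply trace_eq_zero_of_isNilpotent
    refine isNilpotent_of_filtration (N := fun n => N n ⊓ (N n).comap J) (m := m)
      (by simp [h0]) (by simp [hm]) fun n v hv => ?_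
    obtain ⟨hv, hv' : J v ∈ N n⟩ := hv
    have e : J (B (J y) v + B y (J v)) = B (J y) (J v) - B y v := by
      rw [← hJ.map_bracket, hJ.sq]
      abel
    refine ⟨(N (n + 1)).add_mem (hN n _ _ hv) (hN n _ _ hv'), ?_⟩
    change J (B (J y) v + B y (J v)) ∈ N (n + 1)
    rw [e]
    exact (N (n + 1)).sub_mem (hN n _ _ hv') (hN n _ _ hv)
  rwa [map_add, h1, zero_add] at h2

end Trace

/-! ### Sums over a split basis -/

section SplitBasis

variable {ι : Type*} [Fintype ι] [DecidableEq ι] {Q : LinearMap.BilinForm ℝ E}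
  {K : Module.End ℝ E} {e : Module.Basis ι ℝ E} {s : ι → ℝ} (he : IsSplitBasis Q K e s)
include he

namespace IsSplitBasis

omit [Fintype ι] in
theorem sign_mul_self (i : ι) : s i * s i = 1 := by
  rcases he.sign i with h | h <;> simp [h]

theorem repr_apply (x : E) (i : ι) : e.repr x i = s i * Q x (e i) := by
  conv_rhs => rw [← e.sum_repr x]
  simp only [map_sum, map_smul, LinearMap.sum_apply, LinearMap.smul_apply, he.form, smul_eq_mul,
    mul_ite, mul_zero, Finset.sum_ite_eq', Finset.mem_univ, if_true]
  rw [mul_comm, mul_assoc, he.sign_mul_self, mul_one]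

theorem sum_smul (x : E) : ∑ i, (s i * Q x (e i)) • e i = x := by
  simp only [← he.repr_apply, e.sum_repr]

theorem form_eq_sum (x y : E) : Q x y = ∑ i, s i * (Q x (e i) * Q y (e i)) := by
  conv_lhs => rw [← he.sum_smul y]
  simp only [map_sum, map_smul, smul_eq_mul]
  exact Finset.sum_congr rfl fun i _ => by ring

theorem trace_eq_sum (T : Module.End ℝ E) :
    LinearMap.trace ℝ E T = ∑ i, s i * Q (T (e i)) (e i) := by
  rw [LinearMap.trace_eq_matrix_trace ℝ e, Matrix.trace]
  simp only [Matrix.diag_apply, LinearMap.toMatrix_apply, he.repr_apply]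

/-- For a `Q`-skew `J` with `J K = K J`, the tensor `∑ e i ⊗ e i` over the `+1`-eigenvectors is
`J`-invariant: moving `J` from one factor to the other changes the sign. The weight `(1 + s i) / 2`
is the indicator of the `+1`-eigenvectors. -/
theorem sum_apply_left {J : Module.End ℝ E} (hskew : ∀ u v, Q (J u) v = -Q u (J v))
    (hQ : ∀ u v, Q u v = Q v u) (hKQ : ∀ u v, Q (K u) v = Q u (K v))
    (hJK : ∀ u, J (K u) = K (J u)) (F : LinearMap.BilinForm ℝ E) :
    ∑ i, (1 + s i) / 2 * F (J (e i)) (e i) = -∑ i, (1 + s i) / 2 * F (e i) (J (e i)) := by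
  have hoff : ∀ i k, s i * Q (J (e i)) (e k) = s k * Q (J (e i)) (e k) := fun i k => by
    have h := hKQ (J (e i)) (e k)
    rw [← hJK, he.apply, he.apply] at h
    simpa using h
  have hl : ∀ i, (1 + s i) / 2 * F (J (e i)) (e i) =
      ∑ k, (1 + s i) / 2 * (s k * Q (J (e i)) (e k)) * F (e k) (e i) := fun i => by
    conv_lhs => rw [← he.sum_smul (J (e i))]
    simp only [map_sum, map_smul, LinearMap.sum_apply, LinearMap.smul_apply, smul_eq_mul,
      Finset.mul_sum, mul_assoc]
  have hr : ∀ i, (1 + s i) / 2 * F (e i) (J (e i)) =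
      ∑ k, (1 + s i) / 2 * (s k * Q (J (e i)) (e k)) * F (e i) (e k) := fun i => by
    conv_lhs => rw [← he.sum_smul (J (e i))]
    simp only [map_sum, map_smul, smul_eq_mul, Finset.mul_sum, mul_assoc]
  simp only [hl, hr]
  rw [Finset.sum_comm, ← Finset.sum_neg_distrib]
  refine Finset.sum_congr rfl fun k _ => ?_
  rw [← Finset.sum_neg_distrib]
  refine Finset.sum_congr rfl fun i _ => ?_
  have h1 : Q (J (e i)) (e k) = -Q (J (e k)) (e i) := by rw [hskew, hQ]
  have h2 := hoff i k
  rw [h1] at h2 ⊢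
  linear_combination (-(F (e k) (e i)) / 2) * h2

end IsSplitBasis
end SplitBasis

end Abstract

/-! ### Quadratic relations between structure constants -/

section Sums

variable {ι : Type*} [Fintype ι]

theorem sum_swap₀₁ (f : ι → ι → ι → ℝ) :
    ∑ i, ∑ j, ∑ k, f j i k = ∑ i, ∑ j, ∑ k, f i j k := Finset.sum_comm

theorem sum_swap₁₂ (f : ι → ι → ι → ℝ) :
    ∑ i, ∑ j, ∑ k, f i k j = ∑ i, ∑ j, ∑ k, f i j k :=
  Finset.sum_congr rfl fun _ _ => Finset.sum_comm

/-- The system of quadratic relations between structure constants. Here `c i j k = Q [eᵢ, eⱼ] eₖ`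
and `d i j k = Q [J eᵢ, J eⱼ] eₖ`. Write `α`, `β`, `γ`, `δ` for the squared norms of the components
of `c` with index signs `+++`, `++-`, `+--`, `---`. The vanishing of the Killing form gives
`α - 2 β + γ = 0` and `δ - 2 γ + β = 0`; the remaining hypotheses give `α = 3 β`. Hence
`β + γ = 0`, and all four norms vanish. -/
theorem structureConstants_eq_zero {c d : ι → ι → ι → ℝ} {s : ι → ℝ}
    (hs : ∀ i, s i = 1 ∨ s i = -1)
    (h01 : ∀ i j k, c j i k = -c i j k) (h12 : ∀ i j k, c i k j = -c i j k)
    (hkilling : ∀ i, ∑ j, ∑ k, s j * (s k * c i j k ^ 2) = 0)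
    (hjacobi : ∑ i, ∑ j, ∑ k,
      (1 + s i) / 2 * ((1 + s j) / 2) * (s k * (c i j k * d i j k)) = 0)
    (hppp : ∀ i j k, s i = 1 → s j = 1 → s k = 1 → c i j k = d i j k - d i k j + d j k i)
    (hppm : ∀ i j k, s i = 1 → s j = 1 → s k = -1 → d i j k = c i j k) (i j k : ι) :
    c i j k = 0 := by
  let p : ι → ℝ := fun i => (1 + s i) / 2
  let q : ι → ℝ := fun i => (1 - s i) / 2
  have hp : ∀ i, 0 ≤ p i := fun i => by rcases hs i with h | h <;> simp [p, h]
  have hq : ∀ i, 0 ≤ q i := fun i => by rcases hs i with h | h <;> simp [q, h]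
  have hspq : ∀ i, s i = p i - q i := fun i => by simp only [p, q]; ring
  have h1pq : ∀ i, 1 = p i + q i := fun i => by simp only [p, q]; ring
  have c01 : ∀ i j k, c j i k ^ 2 = c i j k ^ 2 := fun i j k => by rw [h01]; ring
  have c12 : ∀ i j k, c i k j ^ 2 = c i j k ^ 2 := fun i j k => by rw [h12]; ring
  let S : (ι → ι → ι → ℝ) → ℝ := fun f => ∑ i, ∑ j, ∑ k, f i j k
  have Sadd : ∀ f g : ι → ι → ι → ℝ, S (fun i j k => f i j k + g i j k) = S f + S g := fun f g => by
    simp only [S, Finset.sum_add_distrib]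
  have Ssub : ∀ f g : ι → ι → ι → ℝ, S (fun i j k => f i j k - g i j k) = S f - S g := fun f g => by
    simp only [S, Finset.sum_sub_distrib]
  have Scongr : ∀ f g : ι → ι → ι → ℝ, (∀ i j k, f i j k = g i j k) → S f = S g := fun f g h => by
    simp only [S, h]
  have Snonneg : ∀ f : ι → ι → ι → ℝ, (∀ i j k, 0 ≤ f i j k) → 0 ≤ S f := fun f h =>
    Finset.sum_nonneg fun i _ => Finset.sum_nonneg fun j _ => Finset.sum_nonneg fun k _ => h i j k
  have S01 : ∀ f : ι → ι → ι → ℝ, S (fun i j k => f j i k) = S f := sum_swap₀₁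
  have S12 : ∀ f : ι → ι → ι → ℝ, S (fun i j k => f i k j) = S f := sum_swap₁₂
  -- `W u v w` is the squared norm of `c` weighted by `u`, `v`, `w` in its three indices.
  let W : (ι → ℝ) → (ι → ℝ) → (ι → ℝ) → ℝ :=
    fun u v w => S fun i j k => u i * v j * w k * c i j k ^ 2
  have W01 : ∀ u v w, W v u w = W u v w := fun u v w => by
    simp only [W]
    rw [← S01]
    exact Scongr _ _ fun i j k => by rw [c01]; ring
  have W12 : ∀ u v w, W u w v = W u v w := fun u v w => by
    simp only [W]
    rw [← S12]
    exact Scongr _ _ fun i j k => by rw [c12]; ring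
  have Wnonneg : ∀ u v w : ι → ℝ, (∀ i, 0 ≤ u i) → (∀ i, 0 ≤ v i) → (∀ i, 0 ≤ w i) →
      0 ≤ W u v w := fun u v w hu hv hw => Snonneg _ fun i j k =>
    mul_nonneg (mul_nonneg (mul_nonneg (hu i) (hv j)) (hw k)) (sq_nonneg _)
  have hK : ∀ u : ι → ℝ, W u p p - 2 * W u p q + W u q q = 0 := fun u => by
    have h : W u s s = 0 := by
      refine Finset.sum_eq_zero fun i _ => ?_
      rw [← mul_zero (u i), ← hkilling i]
      simp only [Finset.mul_sum]
      exact Finset.sum_congr rfl fun j _ => Finset.sum_congr rfl fun k _ => by ring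
    have h' : W u s s = W u p p - W u p q - W u q p + W u q q := by
      simp only [W]
      rw [← Ssub, ← Ssub, ← Sadd]
      exact Scongr _ _ fun i j k => by rw [hspq j, hspq k]; ring
    rw [W12 u p q] at h'
    linarith
  -- Integrability splits `c` into three terms; each contributes equally to the squared norm.
  have hα : W p p p = 3 * S fun i j k => p i * p j * p k * (c i j k * d i j k) := by
    let T : ι → ι → ι → ℝ := fun i j k => p i * p j * p k * (c i j k * d i j k)
    have h : W p p p = S T + S (fun i j k => T i k j) + S (fun i j k => T j k i) := by
      rw [← Sadd, ← Sadd]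
      refine Scongr _ _ fun i j k => ?_
      simp only [T]
      rcases hs i with hi | hi
      · rcases hs j with hj | hj
        · rcases hs k with hk | hk
          · have hc : c j k i = c i j k := by rw [h12 j i k, h01 i j k, neg_neg]
            rw [h12 i j k, hc]
            linear_combination (p i * p j * p k * c i j k) * hppp i j k hi hj hk
          · have : p k = 0 := by simp [p, hk]
            simp [this]
        · have : p j = 0 := by simp [p, hj]
          simp [this]
      · have : p i = 0 := by simp [p, hi]
        simp [this]
    have h2 : S (fun i j k => T j k i) = S T := by
      rw [← S12 T, ← S01 fun i j k => T i k j]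
    rw [h, S12 T, h2]
    ring
  have hβ : W p p p = 3 * W p p q := by
    have h : S (fun i j k => p i * p j * (s k * (c i j k * d i j k))) =
        S (fun i j k => p i * p j * p k * (c i j k * d i j k)) - W p p q := by
      simp only [W]
      rw [← Ssub]
      refine Scongr _ _ fun i j k => ?_
      rcases hs k with hk | hk
      · simp only [p, q, hk]; ring
      · rcases hs i with hi | hi
        · rcases hs j with hj | hj
          · rw [hppm i j k hi hj hk]
            simp only [p, q, hk]; ring
          · have : p j = 0 := by simp [p, hj]
            simp [this]
        · have : p i = 0 := by simp [p, hi]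
          simp [this]
    have h0 : S (fun i j k => p i * p j * (s k * (c i j k * d i j k))) = 0 := hjacobi
    linarith
  have hKp := hK p
  have hKq := hK q
  have e1 : W q p p = W p p q := by rw [W01 p q p, W12 p p q]
  have e2 : W q p q = W p q q := W01 p q q
  have n1 := Wnonneg p p q hp hp hq
  have n2 := Wnonneg p q q hp hq hq
  have htot : S (fun i j k => c i j k ^ 2) = W p p p + 3 * W p p q + 3 * W p q q + W q q q := by
    have h : S (fun i j k => c i j k ^ 2) = W p p p + W p p q + W p q p + W p q q + W q p p
        + W q p q + W q q p + W q q q := by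
      simp only [W]
      simp only [← Sadd]
      refine Scongr _ _ fun i j k => ?_
      linear_combination (c i j k ^ 2) * (h1pq i) + (c i j k ^ 2 * (p i + q i)) * (h1pq j)
        + (c i j k ^ 2 * (p i + q i) * (p j + q j)) * (h1pq k)
    have e3 : W q q p = W p q q := by rw [W12 q p q, e2]
    rw [h, W12 p p q, e1, e2, e3]
    ring
  have hzero : S (fun i j k => c i j k ^ 2) = 0 := by rw [htot]; linarith
  have z1 := (Finset.sum_eq_zero_iff_of_nonneg fun i _ => Finset.sum_nonneg fun j _ =>
    Finset.sum_nonneg fun k _ => sq_nonneg (c i j k)).mp hzero i (Finset.mem_univ i)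
  have z2 := (Finset.sum_eq_zero_iff_of_nonneg fun j _ =>
    Finset.sum_nonneg fun k _ => sq_nonneg (c i j k)).mp z1 j (Finset.mem_univ j)
  have z3 := (Finset.sum_eq_zero_iff_of_nonneg fun k _ => sq_nonneg (c i j k)).mp z2 k
    (Finset.mem_univ k)
  exact pow_eq_zero_iff two_ne_zero |>.mp z3

end Sums

/-! ### Vanishing of the bracket -/

section Main

variable {E : Type*} [AddCommGroup E] [Module ℝ E] {B : LinearMap.BilinMap ℝ E E}
  {Q : LinearMap.BilinForm ℝ E}

theorem IsIntegrableComplex.skew {J : Module.End ℝ E} (hJ : IsIntegrableComplex B Q J) (u v : E) :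
    Q (J u) v = -Q u (J v) := by
  rw [← hJ.orthogonal u (J v), hJ.sq, map_neg, neg_neg]

/-- The Jacobi identity together with the invariance of `Q`. -/
theorem IsNilpotentQuadratic.form_bracket_bracket (hB : IsNilpotentQuadratic B Q) (a a' b b' : E) :
    Q (B a a') (B b b') = Q (B a b) (B a' b') - Q (B a' b) (B a b') := by
  have h : Q (B a a') (B b b') = Q (B (B a a') b) b' := by
    rw [hB.symm, hB.cyclic, hB.cyclic]
  rw [h, hB.leibniz, map_sub, LinearMap.sub_apply, hB.invariant a, hB.invariant a' (B a b)]
  ring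

/-- An abstract generalized Kähler structure on a nilpotent quadratic Lie algebra forces the bracket
to vanish. With `K = J₁ J₂` one has `J₂ = -J₁` on the `+1`-eigenspace of `K` and `J₂ = J₁` on the
`-1`-eigenspace. -/
theorem bracket_eq_zero [FiniteDimensional ℝ E] (hB : IsNilpotentQuadratic B Q)
    {J₁ J₂ : Module.End ℝ E} (h₁ : IsIntegrableComplex B Q J₁) (h₂ : IsIntegrableComplex B Q J₂)
    (hcomm : ∀ u, J₁ (J₂ u) = J₂ (J₁ u)) (hpos : ∀ u, u ≠ 0 → 0 < Q (J₁ (J₂ u)) u) (u v : E) :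
    B u v = 0 := by
  let K : Module.End ℝ E := J₁ * J₂
  have hK : ∀ u, K (K u) = u := fun u => by
    change J₁ (J₂ (J₁ (J₂ u))) = u
    rw [← hcomm, h₁.sq, h₂.sq, neg_neg]
  have hKQ : ∀ u v, Q (K u) v = Q u (K v) := fun u v => by
    change Q (J₁ (J₂ u)) v = Q u (J₁ (J₂ v))
    rw [h₁.skew, h₂.skew, neg_neg, hcomm]
  have hJK : ∀ u, J₁ (K u) = K (J₁ u) := fun u => by
    change J₁ (J₁ (J₂ u)) = J₁ (J₂ (J₁ u))
    rw [hcomm u]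
  obtain ⟨n, e, s, he⟩ := exists_isSplitBasis hB.symm hK hKQ hpos
  have hJ₂ : ∀ i, J₂ (e i) = -(s i • J₁ (e i)) := fun i => by
    have h := congrArg J₁ (he.apply i)
    change J₁ (J₁ (J₂ (e i))) = _ at h
    rw [h₁.sq, map_smul] at h
    rw [← h, neg_neg]
  have hplus : ∀ i, s i = 1 → J₂ (e i) = -J₁ (e i) := fun i hi => by rw [hJ₂, hi, one_smul]
  have hminus : ∀ i, s i = -1 → J₂ (e i) = J₁ (e i) := fun i hi => by
    rw [hJ₂, hi, neg_smul, one_smul, neg_neg]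
  -- Since `J₂ (e i) = -s i • J₁ (e i)`, the operator `(J₁ - J₂) / 2` is `J₁` composed with the
  -- projection to the `+1`-eigenspace, so both traces together give a sum over that space alone.
  have htrace : ∀ y, ∑ i, (1 + s i) / 2 * Q (B (e i) (J₁ (e i))) y = 0 := fun y => by
    have t₁ := hB.trace_bracket_mul h₁ y
    have t₂ := hB.trace_bracket_mul h₂ y
    rw [he.trace_eq_sum] at t₁ t₂
    have e₂ : ∀ i, s i * Q ((B y * J₂) (e i)) (e i) = -Q (B y (J₁ (e i))) (e i) := fun i => by
      simp only [Module.End.mul_apply, hJ₂, map_neg, map_smul, LinearMap.neg_apply,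
        LinearMap.smul_apply, smul_eq_mul]
      linear_combination (-Q (B y (J₁ (e i))) (e i)) * he.sign_mul_self i
    have hi : ∀ i, (1 + s i) / 2 * Q (B (e i) (J₁ (e i))) y =
        (1 / 2) * (s i * Q ((B y * J₂) (e i)) (e i))
          - (1 / 2) * (s i * Q ((B y * J₁) (e i)) (e i)) := fun i => by
      rw [e₂, hB.cyclic, hB.skew (J₁ (e i)) y, map_neg, LinearMap.neg_apply]
      simp only [Module.End.mul_apply]
      ring
    simp only [hi, Finset.sum_sub_distrib, ← Finset.mul_sum, t₁, t₂]
    ring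
  -- Pairing the vector of `htrace` with itself, the Jacobi identity yields two terms, which agree
  -- after `J₁` is moved from one factor of the invariant tensor to the other.
  have hjacobi : ∑ i, ∑ j, (1 + s i) / 2 * ((1 + s j) / 2) *
      Q (B (e i) (e j)) (B (J₁ (e i)) (J₁ (e j))) = 0 := by
    have hj : ∀ j, ∑ i, (1 + s i) / 2 * Q (B (e i) (e j)) (B (J₁ (e i)) (J₁ (e j))) = 0 := by
      intro j
      let F : LinearMap.BilinForm ℝ E :=
        Q.compl₁₂ (B.flip (e j)) (B.flip (J₁ (e j)))
      have hF := he.sum_apply_left h₁.skew hB.symm hKQ hJK F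
      have hz := htrace (B (e j) (J₁ (e j)))
      have hi : ∀ i, (1 + s i) / 2 * Q (B (e i) (J₁ (e i))) (B (e j) (J₁ (e j))) =
          (1 + s i) / 2 * F (e i) (J₁ (e i)) - (1 + s i) / 2 * F (J₁ (e i)) (e i) := fun i => by
        rw [hB.form_bracket_bracket]
        simp only [F, LinearMap.compl₁₂_apply, LinearMap.flip_apply]
        ring
      simp only [hi, Finset.sum_sub_distrib, hF] at hz
      simp only [F, LinearMap.compl₁₂_apply, LinearMap.flip_apply] at hz
      linarith
    rw [Finset.sum_comm]
    refine Finset.sum_eq_zero fun j _ => ?_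
    rw [← mul_zero ((1 + s j) / 2), ← hj j, Finset.mul_sum]
    exact Finset.sum_congr rfl fun i _ => by ring
  have hc : ∀ i j k, Q (B (e i) (e j)) (e k) = 0 := by
    refine structureConstants_eq_zero (d := fun i j k => Q (B (J₁ (e i)) (J₁ (e j))) (e k))
      he.sign (fun i j k => hB.swap₀₁ _ _ _) (fun i j k => hB.swap₁₂ _ _ _) (fun i => ?_) ?_ ?_ ?_
    · have h := hB.trace_bracket_sq (e i)
      rw [he.trace_eq_sum] at h
      rw [← neg_eq_zero, ← h, ← Finset.sum_neg_distrib]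
      refine Finset.sum_congr rfl fun j _ => ?_
      rw [Module.End.mul_apply, hB.invariant, he.form_eq_sum, mul_neg, Finset.mul_sum]
      exact congrArg _ (Finset.sum_congr rfl fun k _ => by ring)
    · rw [← hjacobi]
      refine Finset.sum_congr rfl fun i _ => Finset.sum_congr rfl fun j _ => ?_
      rw [he.form_eq_sum, Finset.mul_sum]
    · intro i j k _ _ _
      rw [h₁.form_eq (e i) (e j) (e k), hB.swap₁₂ (J₁ (e i)) (J₁ (e k)) (e j),
        hB.cyclic (e i) (J₁ (e j)) (J₁ (e k))]
      ring
    -- Integrability of `J₁` and of `J₂`, whose signs differ on these vectors, added together.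
    · intro i j k hi hj hk
      have t₁ := h₁.form_eq (e i) (e j) (e k)
      have t₂ := h₂.form_eq (e i) (e j) (e k)
      rw [hplus i hi, hplus j hj, hminus k hk] at t₂
      simp only [map_neg, LinearMap.neg_apply, neg_neg] at t₂
      linarith
  have hB0 : ∀ i j, B (e i) (e j) = 0 := fun i j => by
    rw [← he.sum_smul (B (e i) (e j))]
    simp [hc]
  have h0 : B = 0 := e.ext fun i => e.ext fun j => by simpa using hB0 i j
  rw [h0]; rfl

end Main

/-! ### Application to the Courant bracket -/

section Application

variable {𝔤 : Type*} [LieRing 𝔤] [LieAlgebra ℝ 𝔤]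

theorem isNilpotentQuadratic_courantBracket (hnil : LieRing.IsNilpotent 𝔤)
    {H : 𝔤 [⋀^Fin 3]→ₗ[ℝ] ℝ} (hH : IsClosedThreeForm H) :
    IsNilpotentQuadratic (courantBracket H) (pairingForm 𝔤) where
  symm := pairing_comm
  skew := courantBracket_skew H
  leibniz := courantBracket_leibniz hH
  invariant := pairing_courantBracket H
  nilpotent := by
    obtain ⟨c, hc⟩ := (LieModule.isNilpotent_iff ℝ 𝔤 𝔤).mp hnil
    exact ⟨courantFiltration 𝔤 c, 2 * c, courantFiltration_zero hc, courantFiltration_two_mul hc,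
      fun n u v hv => courantBracket_mem_courantFiltration H hc n u hv⟩

theorem IsGeneralizedComplex.isIntegrableComplex {H : 𝔤 [⋀^Fin 3]→ₗ[ℝ] ℝ}
    {J : Module.End ℝ (𝔤 × Module.Dual ℝ 𝔤)} (hJ : IsGeneralizedComplex H J) :
    IsIntegrableComplex (courantBracket H) (pairingForm 𝔤) J where
  sq := hJ.sq
  orthogonal := hJ.orthogonal
  map_bracket := hJ.map_bracket

end Application

end GenKahler

theorem theorem4p1 {𝔤 : Type*} [LieRing 𝔤] [LieAlgebra ℝ 𝔤] [FiniteDimensional ℝ 𝔤]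
    (hnil : LieRing.IsNilpotent 𝔤)
    (H : 𝔤 [⋀^Fin 3]→ₗ[ℝ] ℝ) (hH : GenKahler.IsClosedThreeForm H)
    (hGK : ∃ J₁ J₂ : Module.End ℝ (𝔤 × Module.Dual ℝ 𝔤), GenKahler.IsGeneralizedKahler H J₁ J₂) :
    IsLieAbelian 𝔤 := by
  obtain ⟨J₁, J₂, h⟩ := hGK
  refine ⟨fun X Y => ?_⟩
  have h0 := GenKahler.bracket_eq_zero (GenKahler.isNilpotentQuadratic_courantBracket hnil hH)
    h.left.isIntegrableComplex h.right.isIntegrableComplex h.comm h.pos (X, 0) (Y, 0)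
  exact congrArg Prod.fst h0
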